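/- Rings need not have a unit. Let $A$ be a (not necessarily unital) $C^*$-algebra. By an ideal of a ring $R$ we mean a two-sided ideal, that is, an additive subgroup $I \subseteq R$ with $aI \cup Ia \subseteq I$ for all $a \in R$ (for $R = A$, it need be neither norm-closed nor closed under multiplication by complex scalars); a one-sided ideal of $R$ is an additive subgroup $J$ such that $aJ \subseteq J$ for all $a \in R$, or $Ja \subseteq J$ for all $a \in R$. A prime ideal of $R$ is an ideal $P \neq R$ such that, for all ideals $J, K$ of $R$ with $JK \subseteq P$, one has $J \subseteq P$ or $K \subseteq P$, where $JK$ is the additive subgroup generated by the products $xy$ with $x \in J$, $y \in K$. For an ideal $I$ of $R$, let $\sqrt{I}$ denote the intersection of all prime ideals of $R$ containing $I$, with $\sqrt{I} = R$ if there are none. The lower nilradical of $R$ is $\mathrm{Nil}_*(R) := \sqrt{0}$, and the upper nilradical $\mathrm{Nil}^*(R)$ is the largest ideal of $R$ all of whose elements are nilpotent. Let $I$ be an ideal of $A$. Then: 1. If $J \subseteq A$ is a one-sided ideal that is radical over $I$, that is, for every $x \in J$ there exists $n \geq 1$ with $x^n \in I$, then $J \subseteq \sqrt{I}$. 2. $\mathrm{Nil}_*(A/I)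 = \mathrm{Nil}^*(A/I)$. 3. Köthe's conjecture holds for the ring $A/I$: every one-sided ideal of $A/I$ all of whose elements are nilpotent is contained in $\mathrm{Nil}^*(A/I)$. -/

import Mathlib

namespace RingRadicals

/-- Positive powers in a ring that need not have a unit: `posPow x k` is `x ^ (k + 1)`, so that
`∃ k : ℕ, P (posPow x k)` says that `P (x ^ n)` holds for some `n ≥ 1`. -/
def posPow {R : Type*} [NonUnitalRing R] (x : R) : ℕ → R
  | 0 => x
  | k + 1 => posPow x k * x

theorem posPow_eq_pow {R : Type*} [Ring R] (x : R) (k : ℕ) : posPow x k = x ^ (k + 1) := by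
  induction k with
  | zero => simp [posPow]
  | succ k ih => rw [posPow, ih, ← pow_succ]

/-- An additive subgroup `J` is a left ideal if `R J ⊆ J`. -/
def IsLeftIdeal {R : Type*} [NonUnitalRing R] (J : AddSubgroup R) : Prop :=
  ∀ a : R, ∀ x ∈ J, a * x ∈ J

/-- An additive subgroup `J` is a right ideal if `J R ⊆ J`. -/
def IsRightIdeal {R : Type*} [NonUnitalRing R] (J : AddSubgroup R) : Prop :=
  ∀ a : R, ∀ x ∈ J, x * a ∈ J

/-- A one-sided ideal is a left ideal or a right ideal. -/
def IsOneSidedIdeal {R : Type*} [NonUnitalRing R] (J : AddSubgroup R) : Prop :=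
  IsLeftIdeal J ∨ IsRightIdeal J

/-- A subset `S` is radical over the ideal `I` if every element of `S` has a positive power
in `I`. -/
def IsRadicalOver {R : Type*} [NonUnitalRing R] (S : Set R) (I : TwoSidedIdeal R) : Prop :=
  ∀ x ∈ S, ∃ k : ℕ, posPow x k ∈ I

/-- A subset is nil if each of its elements is nilpotent. -/
def IsNil {R : Type*} [NonUnitalRing R] (S : Set R) : Prop :=
  ∀ x ∈ S, ∃ k : ℕ, posPow x k = 0

/-- The two-sided ideal `P` is prime if `P ≠ R` and, for all two-sided ideals `J` and `K` with
`J K ⊆ P`, one has `J ⊆ P` or `K ⊆ P`. The ideal `J K` is the additive subgroup generated by the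
products `x * y` with `x ∈ J` and `y ∈ K`. -/
def IsPrimeIdeal {R : Type*} [NonUnitalRing R] (P : TwoSidedIdeal R) : Prop :=
  P ≠ ⊤ ∧ ∀ J K : TwoSidedIdeal R,
    (AddSubgroup.closure {z : R | ∃ x ∈ J, ∃ y ∈ K, z = x * y} : Set R) ⊆ (P : Set R) →
      J ≤ P ∨ K ≤ P

/-- The semiprime closure `√I`: the intersection of all prime ideals that contain `I` (it is the
whole ring if there are none). -/
def semiprimeClosure {R : Type*} [NonUnitalRing R] (I : TwoSidedIdeal R) : TwoSidedIdeal R :=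
  sInf {P : TwoSidedIdeal R | IsPrimeIdeal P ∧ I ≤ P}

/-- The lower nilradical, or prime radical: the semiprime closure of the zero ideal. -/
def lowerNilradical (R : Type*) [NonUnitalRing R] : TwoSidedIdeal R :=
  semiprimeClosure (⊥ : TwoSidedIdeal R)

/-- The upper nilradical: the sum of all two-sided nil ideals. It is the largest two-sided nil
ideal by `isGreatest_upperNilradical`. -/
def upperNilradical (R : Type*) [NonUnitalRing R] : TwoSidedIdeal R :=
  sSup {N : TwoSidedIdeal R | IsNil (N : Set R)}

theorem posPow_mul_posPow {R : Type*} [NonUnitalRing R] (x : R) (m n : ℕ) :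
    posPow x m * posPow x n = posPow x (m + n + 1) := by
  induction n with
  | zero => rfl
  | succ n ih =>
    rw [posPow, ← mul_assoc, ih]
    rfl

theorem exists_posPow_posPow {R : Type*} [NonUnitalRing R] (x : R) (n m : ℕ) :
    ∃ k, posPow (posPow x n) m = posPow x k := by
  induction m with
  | zero => exact ⟨n, rfl⟩
  | succ m ih =>
    obtain ⟨k, hk⟩ := ih
    exact ⟨k + n + 1, by rw [posPow, hk, posPow_mul_posPow]⟩

theorem isNil_sup {R : Type*} [NonUnitalRing R] {N M : TwoSidedIdeal R}
    (hN : IsNil (N : Set R)) (hM : IsNil (M : Set R)) :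
    IsNil ((N ⊔ M : TwoSidedIdeal R) : Set R) := by
  intro x hx
  obtain ⟨a, ha, b, hb, rfl⟩ := TwoSidedIdeal.mem_sup.1 hx
  have key : ∀ n, posPow (a + b) n - posPow a n ∈ M := by
    intro n
    induction n with
    | zero => simpa [posPow] using hb
    | succ n ih =>
      have e : posPow (a + b) (n + 1) - posPow a (n + 1)
          = (posPow (a + b) n - posPow a n) * a + posPow (a + b) n * b := by
        simp only [posPow, mul_add, sub_mul]
        abel
      rw [e]
      exact M.add_mem (M.mul_mem_right _ _ ih) (M.mul_mem_left _ _ hb)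
  obtain ⟨n, hn⟩ := hN a ha
  have h := key n
  rw [hn, sub_zero] at h
  obtain ⟨m, hm⟩ := hM _ h
  obtain ⟨k, hk⟩ := exists_posPow_posPow (a + b) n m
  exact ⟨k, by rw [← hk, hm]⟩

theorem isGreatest_upperNilradical (R : Type*) [NonUnitalRing R] :
    IsGreatest {N : TwoSidedIdeal R | IsNil (N : Set R)} (upperNilradical R) := by
  let K : TwoSidedIdeal R := TwoSidedIdeal.mk'
    {x | ∃ N : TwoSidedIdeal R, IsNil (N : Set R) ∧ x ∈ N}
    ⟨⊥, fun x hx => ⟨0, by simpa [posPow] using hx⟩, TwoSidedIdeal.zero_mem _⟩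
    (by
      rintro x y ⟨N, hN, hx⟩ ⟨M, hM, hy⟩
      exact ⟨N ⊔ M, isNil_sup hN hM, TwoSidedIdeal.add_mem _ (TwoSidedIdeal.mem_sup_left hx)
        (TwoSidedIdeal.mem_sup_right hy)⟩)
    (by
      rintro x ⟨N, hN, hx⟩
      exact ⟨N, hN, N.neg_mem hx⟩)
    (by
      rintro x y ⟨N, hN, hx⟩
      exact ⟨N, hN, N.mul_mem_left _ _ hx⟩)
    (by
      rintro x y ⟨N, hN, hx⟩
      exact ⟨N, hN, N.mul_mem_right _ _ hx⟩)
  have hle : upperNilradical R ≤ K := by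
    refine sSup_le fun N hN x hx => ?_
    exact (TwoSidedIdeal.mem_mk' _ _ _ _ _ _ x).2 ⟨N, hN, hx⟩
  refine ⟨fun x hx => ?_, fun N hN => le_sSup hN⟩
  obtain ⟨N, hN, hxN⟩ := (TwoSidedIdeal.mem_mk' _ _ _ _ _ _ x).1 (hle hx)
  exact hN x hxN

end RingRadicals

/-! Everything reduces to a one-sided ideal `J` of `A` radical over a prime ideal `P`, which need
not be closed. Primes are semiprime, and a semiprime ideal contains all positive powers of its
positive elements (`IsSemiprimeIdeal.nnrpow_mem_of_pos`). If `J` is a left ideal and `x ∈ J`, then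
`b = star x * x` lies in `J`, so a power of `b` lies in `P`, hence so does `b ^ (1/3)`. Since `x = r
* b ^ (1/3)` for some `r` (`exists_eq_mul_of_star_mul_self_le`), `x ∈ P`. Right ideals use `x * star
x`.

Primes of `A/I` pull back to semiprime ideals of `A`, so nil one-sided ideals of `A/I` lie in the
lower nilradical. The upper nilradical is one of these, and the lower one is nil by Zorn's lemma, so
the two agree. -/

namespace RingRadicals

/-! ### Prime and semiprime ideals without a unit -/

section Algebraic

variable {R : Type*} [NonUnitalRing R]

/-- The elementwise form of semiprimeness: `f R f ⊆ P` implies `f ∈ P`. -/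
def IsSemiprimeIdeal (P : TwoSidedIdeal R) : Prop :=
  ∀ f : R, (∀ a : R, f * a * f ∈ P) → f ∈ P

theorem IsPrimeIdeal.mem_or_mem_of_mul_mem {P : TwoSidedIdeal R} (hP : IsPrimeIdeal P)
    (J K : TwoSidedIdeal R) (h : ∀ x ∈ J, ∀ y ∈ K, x * y ∈ P) : J ≤ P ∨ K ≤ P := by
  refine hP.2 J K fun z hz => ?_
  induction hz using AddSubgroup.closure_induction with
  | mem z hz =>
    obtain ⟨x, hx, y, hy, rfl⟩ := hz
    exact h x hx y hy
  | zero => exact P.zero_mem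
  | add x y _ _ hx hy => exact P.add_mem hx hy
  | neg x _ hx => exact P.neg_mem hx

/-- With `F` the ideal generated by `f`, `f R f ⊆ P` extends one side at a time to `F R F ⊆ P`.
Without a unit this does not yet say `F F ⊆ P`, so primeness is used twice, first on `F` and `K₃ =
{v | F v ⊆ P}`, which contains `F F`. -/
theorem IsPrimeIdeal.isSemiprimeIdeal {P : TwoSidedIdeal R} (hP : IsPrimeIdeal P) :
    IsSemiprimeIdeal P := by
  intro f hf
  let F : TwoSidedIdeal R := TwoSidedIdeal.span {f}
  have hfF : f ∈ F := TwoSidedIdeal.subset_span rfl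
  let K₁ : TwoSidedIdeal R := .mk' {v | ∀ a, f * a * v ∈ P}
    (fun a => by simp)
    (fun hx hy a => by simpa [mul_add] using P.add_mem (hx a) (hy a))
    (fun hx a => by simpa using P.neg_mem (hx a))
    (fun {x y} hy a => by simpa [mul_assoc] using hy (a * x))
    (fun {x y} hx a => by simpa [mul_assoc] using P.mul_mem_right _ y (hx a))
  have h₁ : ∀ v ∈ F, ∀ a, f * a * v ∈ P := by
    have : F ≤ K₁ := TwoSidedIdeal.span_le.2 (by
      rintro _ rfl
      exact (TwoSidedIdeal.mem_mk' ..).2 hf)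
    exact fun v hv => (TwoSidedIdeal.mem_mk' ..).1 (this hv)
  let K₂ : TwoSidedIdeal R := .mk' {u | ∀ v ∈ F, ∀ a, u * a * v ∈ P}
    (fun v _ a => by simp)
    (fun hx hy v hv a => by simpa [add_mul] using P.add_mem (hx v hv a) (hy v hv a))
    (fun hx v hv a => by simpa using P.neg_mem (hx v hv a))
    (fun {x y} hy v hv a => by simpa [mul_assoc] using P.mul_mem_left x _ (hy v hv a))
    (fun {x y} hx v hv a => by simpa [mul_assoc] using hx v hv (y * a))
  have h₂ : ∀ u ∈ F, ∀ v ∈ F, ∀ a, u * a * v ∈ P := by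
    have : F ≤ K₂ := TwoSidedIdeal.span_le.2 (by
      rintro _ rfl
      exact (TwoSidedIdeal.mem_mk' ..).2 h₁)
    exact fun u hu => (TwoSidedIdeal.mem_mk' ..).1 (this hu)
  let K₃ : TwoSidedIdeal R := .mk' {v | ∀ u ∈ F, u * v ∈ P}
    (fun u _ => by simp)
    (fun hx hy u hu => by simpa [mul_add] using P.add_mem (hx u hu) (hy u hu))
    (fun hx u hu => by simpa using P.neg_mem (hx u hu))
    (fun {x y} hy u hu => by simpa [mul_assoc] using hy (u * x) (F.mul_mem_right _ _ hu))
    (fun {x y} hx u hu => by simpa [mul_assoc] using P.mul_mem_right _ y (hx u hu))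
  rcases hP.mem_or_mem_of_mul_mem F K₃
    (fun u hu v hv => (TwoSidedIdeal.mem_mk' ..).1 hv u hu) with h | h
  · exact h hfF
  · rcases hP.mem_or_mem_of_mul_mem F F fun u hu v hv =>
      h ((TwoSidedIdeal.mem_mk' ..).2 fun w hw => by
        simpa [mul_assoc] using h₂ w hw v hv u) with h | h <;> exact h hfF

theorem IsSemiprimeIdeal.comap {S F : Type*} [NonUnitalRing S] [FunLike F R S]
    [NonUnitalRingHomClass F R S] {f : F} (hf : Function.Surjective f) {Q : TwoSidedIdeal S}
    (hQ : IsSemiprimeIdeal Q) : IsSemiprimeIdeal (Q.comap f) := by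
  intro x hx
  rw [TwoSidedIdeal.mem_comap]
  refine hQ _ fun s => ?_
  obtain ⟨a, rfl⟩ := hf s
  simpa [TwoSidedIdeal.mem_comap] using hx a

theorem mem_semiprimeClosure {I : TwoSidedIdeal R} {x : R} :
    x ∈ semiprimeClosure I ↔ ∀ P : TwoSidedIdeal R, IsPrimeIdeal P → I ≤ P → x ∈ P := by
  simp [semiprimeClosure, TwoSidedIdeal.mem_sInf]

/-- An ideal that is maximal among those containing no positive power of `x` is prime. -/
theorem exists_isPrimeIdeal_of_forall_posPow_ne_zero {x : R} (hx : ∀ k, posPow x k ≠ 0) :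
    ∃ P : TwoSidedIdeal R, IsPrimeIdeal P ∧ x ∉ P := by
  obtain ⟨P, -, hP⟩ := zorn_le_nonempty₀ {N : TwoSidedIdeal R | ∀ k, posPow x k ∉ N}
    (fun c hc hch N hN => by
      let U : TwoSidedIdeal R := .mk' {y | ∃ M ∈ c, y ∈ M}
        ⟨N, hN, N.zero_mem⟩
        (by
          rintro y z ⟨M, hM, hy⟩ ⟨M', hM', hz⟩
          rcases hch.total hM hM' with h | h
          · exact ⟨M', hM', M'.add_mem (h hy) hz⟩
          · exact ⟨M, hM, M.add_mem hy (h hz)⟩)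
        (by
          rintro y ⟨M, hM, hy⟩
          exact ⟨M, hM, M.neg_mem hy⟩)
        (by
          rintro y z ⟨M, hM, hy⟩
          exact ⟨M, hM, M.mul_mem_left _ _ hy⟩)
        (by
          rintro y z ⟨M, hM, hy⟩
          exact ⟨M, hM, M.mul_mem_right _ _ hy⟩)
      refine ⟨U, fun k hk => ?_, fun M hM y hy => (TwoSidedIdeal.mem_mk' ..).2 ⟨M, hM, hy⟩⟩
      obtain ⟨M, hM, hk⟩ := (TwoSidedIdeal.mem_mk' ..).1 hk
      exact hc hM k hk) ⊥ (fun k => by simpa using hx k)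
  have key : ∀ J : TwoSidedIdeal R, ¬ J ≤ P → ∃ k, posPow x k ∈ P ⊔ J := by
    intro J hJ
    by_contra! h
    exact hJ (le_sup_right.trans (hP.2 h le_sup_left))
  refine ⟨P, ⟨fun h => hP.1 0 (h ▸ TwoSidedIdeal.mem_top _), fun J K hJK => ?_⟩, hP.1 0⟩
  by_contra! h
  obtain ⟨m, hm⟩ := key J h.1
  obtain ⟨n, hn⟩ := key K h.2
  obtain ⟨p, hp, y, hy, hpy⟩ := TwoSidedIdeal.mem_sup.1 hm
  obtain ⟨q, hq, z, hz, hqz⟩ := TwoSidedIdeal.mem_sup.1 hn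
  refine hP.1 (m + n + 1) ?_
  rw [← posPow_mul_posPow, ← hpy, ← hqz, add_mul, mul_add y]
  exact P.add_mem (P.mul_mem_right _ _ hp) (P.add_mem (P.mul_mem_left _ _ hq)
    (hJK (AddSubgroup.subset_closure ⟨y, hy, z, hz, rfl⟩)))

theorem isNil_lowerNilradical (R : Type*) [NonUnitalRing R] :
    IsNil (lowerNilradical R : Set R) := by
  intro x hx
  by_contra! h
  obtain ⟨P, hP, hxP⟩ := exists_isPrimeIdeal_of_forall_posPow_ne_zero h
  exact hxP (mem_semiprimeClosure.1 hx P hP bot_le)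

theorem map_posPow {S F : Type*} [NonUnitalRing S] [FunLike F R S]
    [NonUnitalRingHomClass F R S] (f : F) (x : R) (k : ℕ) :
    f (posPow x k) = posPow (f x) k := by
  induction k with
  | zero => rfl
  | succ k ih => rw [posPow, map_mul, ih, posPow]

end Algebraic

/-! ### Factorization and roots in C⋆-algebras -/

section CStar

variable {A : Type*} [NonUnitalCStarAlgebra A] [PartialOrder A] [StarOrderedRing A]

theorem posPow_eq_nnrpow {a : A} (ha : 0 ≤ a) (k : ℕ) : posPow a k = a ^ ((k : NNReal) + 1) := by
  induction k with
  | zero => simp [posPow, CFC.nnrpow_one a ha]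
  | succ k ih =>
    rw [posPow, ih, Nat.cast_succ, CFC.nnrpow_add (x := (k : NNReal) + 1) (y := 1)
      (by positivity) one_pos, CFC.nnrpow_one a ha]

theorem norm_mul_cfcₙ_sq_le {x z : A} (hz : 0 ≤ z) (hxz : star x * x ≤ z * z * z)
    {h : ℝ → ℝ} (hc : Continuous h) (h0 : h 0 = 0) {C : ℝ}
    (hC : ∀ t, 0 ≤ t → t ≤ ‖z‖ → t ^ 3 * h t ^ 2 ≤ C) : ‖x * cfcₙ h z‖ ^ 2 ≤ C := by
  set k := cfcₙ h z with hk
  have hks : star k = k := (cfcₙ_predicate h z : IsSelfAdjoint _)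
  have hz' : IsSelfAdjoint z := .of_nonneg hz
  have e : k * (z * z * z) * k = cfcₙ (fun t => h t * (t * t * t) * h t) z := by
    rw [cfcₙ_mul (fun t => h t * (t * t * t)) h z, cfcₙ_mul h (fun t => t * t * t) z,
      cfcₙ_mul (fun t => t * t) (fun t => t) z, cfcₙ_mul (fun t => t) (fun t => t) z,
      cfcₙ_id' ℝ z]
  calc ‖x * k‖ ^ 2 = ‖star (x * k) * (x * k)‖ := by rw [CStarRing.norm_star_mul_self, sq]
    _ = ‖star k * (star x * x) * k‖ := by simp only [star_mul, mul_assoc]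
    _ ≤ ‖star k * (z * z * z) * k‖ :=
        CStarAlgebra.norm_le_norm_of_nonneg_of_le
          (star_left_conjugate_nonneg (star_mul_self_nonneg x) k)
          (star_left_conjugate_le_conjugate hxz k)
    _ ≤ C := by
      rw [hks, e]
      refine norm_cfcₙ_le fun t ht => ?_
      have ht0 : 0 ≤ t := quasispectrum_nonneg_of_nonneg z hz t ht
      have htz : t ≤ ‖z‖ := by
        simpa [abs_of_nonneg ht0, cfcₙ_id' ℝ z] using norm_apply_le_norm_cfcₙ (fun t : ℝ => t) z ht
      have e' : h t * (t * t * t) * h t = t ^ 3 * h t ^ 2 := by ring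
      rw [e', Real.norm_of_nonneg (by positivity)]
      exact hC t ht0 htz

/-- The functions `t ↦ t / (t² + δ²)` approximate the inverse of `t`. -/
theorem regularized_inv_bound {t δ : ℝ} (_ht : 0 ≤ t) (hδ : 0 < δ) :
    t * (δ ^ 2 / (t ^ 2 + δ ^ 2)) ^ 2 ≤ δ / 2 := by
  have h : 0 < t ^ 2 + δ ^ 2 := by positivity
  have h1 : t * (δ ^ 2 / (t ^ 2 + δ ^ 2)) ≤ δ / 2 := by
    rw [mul_div_assoc', div_le_div_iff₀ h two_pos]
    nlinarith [mul_nonneg hδ.le (sq_nonneg (t - δ))]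
  have h2 : δ ^ 2 / (t ^ 2 + δ ^ 2) ≤ 1 := (div_le_one h).2 (by nlinarith [sq_nonneg t])
  have h3 : 0 ≤ δ ^ 2 / (t ^ 2 + δ ^ 2) := by positivity
  calc _ = t * (δ ^ 2 / (t ^ 2 + δ ^ 2)) * (δ ^ 2 / (t ^ 2 + δ ^ 2)) := by ring
    _ ≤ δ / 2 * 1 := by gcongr
    _ = _ := mul_one _

/-- The factor `r` is the limit of `x * g n (z)`, where `g n` is a regularized inverse. By
`norm_mul_cfcₙ_sq_le`, norms of `x * h(z)` are controlled by `t ^ 3 * h t ^ 2`. -/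
theorem exists_eq_mul_of_star_mul_self_le {x z : A} (hz : 0 ≤ z)
    (hxz : star x * x ≤ z * z * z) : ∃ r, x = r * z := by
  have hz' : IsSelfAdjoint z := .of_nonneg hz
  let δ : ℕ → ℝ := fun n => 1 / ((n : ℝ) + 1)
  have hδ : ∀ n, 0 < δ n := fun n => by positivity
  have hδ0 : Filter.Tendsto δ Filter.atTop (nhds 0) := tendsto_one_div_add_atTop_nhds_zero_nat
  let g : ℕ → ℝ → ℝ := fun n t => t / (t ^ 2 + δ n ^ 2)
  have hg : ∀ n, Continuous (g n) := fun n => by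
    refine continuous_id.div (by fun_prop) fun t => ?_
    have := hδ n
    positivity
  have hg0 : ∀ n, g n 0 = 0 := fun n => by simp [g]
  have hgu : ∀ n t, g n t * t = 1 - δ n ^ 2 / (t ^ 2 + δ n ^ 2) := fun n t => by
    have := hδ n
    have : t ^ 2 + δ n ^ 2 ≠ 0 := by positivity
    simp only [g]
    field_simp
    ring
  have hcauchy : CauchySeq fun n => x * cfcₙ (g n) z := by
    refine cauchySeq_of_le_tendsto_0' (fun n => √(2 * δ n)) (fun n m hnm => ?_) ?_
    · rw [dist_eq_norm]
      refine Real.le_sqrt_of_sq_le ?_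
      rw [← mul_sub, ← cfcₙ_sub (g n) (g m) z (hg n).continuousOn (hg0 n) (hg m).continuousOn
        (hg0 m)]
      refine norm_mul_cfcₙ_sq_le hz hxz ((hg n).sub (hg m)) (by simp [hg0]) fun t ht _ => ?_
      have hmn : δ m ≤ δ n := one_div_le_one_div_of_le (by positivity) (by gcongr)
      have e : t ^ 3 * (g n t - g m t) ^ 2 = t * (g n t * t - g m t * t) ^ 2 := by ring
      rw [Pi.sub_apply, e, hgu, hgu]
      -- `t(u - v)² ≤ 2tu² + 2tv² ≤ δ n + δ m ≤ 2 δ n`.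
      have h1 := regularized_inv_bound ht (hδ n)
      have h2 := regularized_inv_bound ht (hδ m)
      set u := δ n ^ 2 / (t ^ 2 + δ n ^ 2)
      set v := δ m ^ 2 / (t ^ 2 + δ m ^ 2)
      nlinarith [mul_nonneg ht (sq_nonneg (u + v))]
    · simpa using ((hδ0.const_mul 2).sqrt)
  obtain ⟨r, hr⟩ := cauchySeq_tendsto_of_complete hcauchy
  refine ⟨r, ?_⟩
  -- The extra factor `z` makes the function vanish at `0`, as the non-unital calculus requires; it
  -- is cancelled afterwards.
  have hlim : Filter.Tendsto (fun n => x * z - x * cfcₙ (g n) z * z * z) Filter.atTop (nhds 0) := by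
    rw [tendsto_zero_iff_norm_tendsto_zero]
    refine squeeze_zero (fun _ => norm_nonneg _) (g := fun n => √(‖z‖ ^ 4 * (δ n / 2)))
      (fun n => ?_) ?_
    · refine Real.le_sqrt_of_sq_le ?_
      have e : x * z - x * cfcₙ (g n) z * z * z = x * cfcₙ (fun t => t - g n t * t * t) z := by
        have := hg n
        rw [cfcₙ_sub (fun t => t) (fun t => g n t * t * t) z (by fun_prop) rfl
          (by fun_prop) (by simp),
          cfcₙ_mul (fun t => g n t * t) (fun t => t) z (by fun_prop) (by simp) (by fun_prop) rfl,
          cfcₙ_mul (g n) (fun t => t) z (by fun_prop) (hg0 n) (by fun_prop) rfl, cfcₙ_id' ℝ z]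
        simp only [mul_sub, mul_assoc]
      rw [e]
      have := hg n
      refine norm_mul_cfcₙ_sq_le hz hxz (by fun_prop) (by simp) fun t ht htz => ?_
      have e : t ^ 3 * (t - g n t * t * t) ^ 2
          = t ^ 4 * (t * (δ n ^ 2 / (t ^ 2 + δ n ^ 2)) ^ 2) := by
        rw [hgu]
        ring
      rw [e]
      have := regularized_inv_bound ht (hδ n)
      gcongr
    · have := ((hδ0.div_const 2).const_mul (‖z‖ ^ 4)).sqrt
      rwa [zero_div, mul_zero, Real.sqrt_zero] at this
  have hwz : (x - r * z) * z = 0 := by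
    rw [sub_mul]
    exact tendsto_nhds_unique
      (tendsto_const_nhds.sub ((hr.mul_const z).mul_const z)) hlim
  have hzw : z * star (x - r * z) = 0 := by
    simpa [hz'.star_eq] using congrArg star hwz
  set w := x - r * z with hw
  have hxw : x * star w = 0 := by
    have h1 : w * (star x * x) * star w ≤ 0 := by
      have := star_right_conjugate_le_conjugate hxz w
      rwa [mul_assoc w (z * z * z), mul_assoc (z * z), hzw, mul_zero, mul_zero] at this
    have h2 : star (x * star w) * (x * star w) = 0 := by
      refine le_antisymm ?_ (star_mul_self_nonneg _)
      simpa [mul_assoc] using h1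
    exact CStarRing.star_mul_self_eq_zero_iff _ |>.1 h2
  have hww : w * star w = 0 := by
    have : w * star w = x * star w - r * (z * star w) := by
      rw [← mul_assoc, ← sub_mul]
    rw [this, hxw, hzw, mul_zero, sub_zero]
  exact sub_eq_zero.1 (CStarRing.mul_star_self_eq_zero_iff _ |>.1 hww)

/-- By semiprimeness it suffices that `f * c * f ∈ P` for positive contractions `c`. Operator
monotonicity of `t ^ (7/8)` bounds `Y ^ (7/8)` by `d ^ (49/32) = z ^ 3`, so `Y ^ (7/8) = r * z ^ 2 *
star r`. The exponent `7/8` works because `z ^ 2 = d ^ (49/48)` still has exponent above `1`. -/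
theorem IsSemiprimeIdeal.nnrpow_mem {P : TwoSidedIdeal A} (hP : IsSemiprimeIdeal P)
    {d : A} (hd : 0 ≤ d) (hdP : d ∈ P) : d ^ (7 / 8 : NNReal) ∈ P := by
  set f := d ^ (7 / 8 : NNReal) with hf
  have hf0 : 0 ≤ f := CFC.nnrpow_nonneg
  have hfs : star f = f := IsSelfAdjoint.of_nonneg hf0
  have hff : f * f = d ^ (7 / 4 : NNReal) := by
    rw [hf, ← CFC.nnrpow_add (by positivity) (by positivity)]
    norm_num
  -- Positive contractions span `A` only over `ℂ`, and `P` need not be closed under scalars, so `l`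
  -- is carried along and later absorbed into the factor `Y ^ (1/8)`.
  have key : ∀ c : A, 0 ≤ c → ‖c‖ ≤ 1 → ∀ l : ℂ, l • (f * c * f) ∈ P := by
    intro c hc hc1 l
    set Y := f * c * f with hY
    have hY0 : 0 ≤ Y := by simpa [hfs] using star_left_conjugate_nonneg hc f
    have hYle : Y ≤ d ^ (7 / 4 : NNReal) := by
      have := CStarAlgebra.star_left_conjugate_le_norm_smul (a := f) (b := c)
      rw [hfs, hff] at this
      refine this.trans ?_
      have h0 : 0 ≤ d ^ (7 / 4 : NNReal) := CFC.nnrpow_nonneg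
      simpa using smul_le_smul_of_nonneg_right hc1 h0
    set z := d ^ (49 / 96 : NNReal) with hz
    set x := Y ^ (7 / 16 : NNReal) with hx
    have hx0 : 0 ≤ x := CFC.nnrpow_nonneg
    have hxs : star x = x := IsSelfAdjoint.of_nonneg hx0
    have hz0 : 0 ≤ z := CFC.nnrpow_nonneg
    have hzs : star z = z := IsSelfAdjoint.of_nonneg hz0
    have hxx : x * x = Y ^ (7 / 8 : NNReal) := by
      rw [hx, ← CFC.nnrpow_add (by positivity) (by positivity)]
      norm_num
    have hxz : star x * x ≤ z * z * z := by
      have h1 : z * z * z = (d ^ (7 / 4 : NNReal)) ^ (7 / 8 : NNReal) := by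
        rw [CFC.nnrpow_nnrpow, hz, ← CFC.nnrpow_add (by positivity) (by positivity),
          ← CFC.nnrpow_add (by positivity) (by positivity)]
        norm_num
      rw [hxs, hxx, h1]
      refine CFC.nnrpow_le_nnrpow ⟨by positivity, ?_⟩ hYle
      rw [div_le_one (by positivity)]
      norm_num
    obtain ⟨r, hr⟩ := exists_eq_mul_of_star_mul_self_le hz0 hxz
    have hzz : z * z ∈ P := by
      have : z * z = d * d ^ (1 / 48 : NNReal) := by
        conv_rhs => lhs; rw [← CFC.nnrpow_one d]
        rw [hz, ← CFC.nnrpow_add (by positivity) (by positivity),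
          ← CFC.nnrpow_add (by positivity) (by positivity)]
        norm_num
      rw [this]
      exact P.mul_mem_right _ _ hdP
    have hYP : Y ^ (7 / 8 : NNReal) ∈ P := by
      have : Y ^ (7 / 8 : NNReal) = r * (z * z) * star r := by
        rw [← hxx]
        nth_rewrite 2 [← hxs]
        rw [hr, star_mul, hzs]
        simp only [mul_assoc]
      rw [this]
      exact P.mul_mem_right _ _ (P.mul_mem_left _ _ hzz)
    have : l • Y = Y ^ (7 / 8 : NNReal) * (l • Y ^ (1 / 8 : NNReal)) := by
      rw [mul_smul_comm, ← CFC.nnrpow_add (by positivity) (by positivity)]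
      norm_num
      rw [CFC.nnrpow_one Y hY0]
    rw [this]
    exact P.mul_mem_right _ _ hYP
  refine hP f fun a => ?_
  have ha : a ∈ Submodule.span ℂ ({x : A | 0 ≤ x} ∩ Metric.closedBall 0 1) := by
    rw [CStarAlgebra.span_nonneg_inter_unitClosedBall]
    trivial
  have : ∀ l : ℂ, l • (f * a * f) ∈ P := by
    induction ha using Submodule.span_induction with
    | mem c hc => exact key c hc.1 (by simpa using hc.2)
    | zero => simp
    | add a b _ _ ha hb =>
      intro l
      rw [mul_add, add_mul, smul_add]
      exact P.add_mem (ha l) (hb l)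
    | smul m a _ ha =>
      intro l
      rw [mul_smul_comm, smul_mul_assoc, smul_smul]
      exact ha _
  simpa using this 1

/-- A semiprime ideal of a C⋆-algebra contains all positive powers of its positive elements. -/
theorem IsSemiprimeIdeal.nnrpow_mem_of_pos {P : TwoSidedIdeal A} (hP : IsSemiprimeIdeal P)
    {d : A} (hd : 0 ≤ d) (hdP : d ∈ P) {p : NNReal} (hp : 0 < p) : d ^ p ∈ P := by
  have hpow : ∀ n : ℕ, d ^ ((7 / 8 : NNReal) ^ n) ∈ P := by
    intro n
    induction n with
    | zero => simpa [CFC.nnrpow_one d hd] using hdP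
    | succ n ih =>
      rw [pow_succ, ← CFC.nnrpow_nnrpow]
      exact hP.nnrpow_mem CFC.nnrpow_nonneg ih
  obtain ⟨n, hn⟩ := exists_pow_lt_of_lt_one (y := (7 / 8 : NNReal)) hp
    (by rw [div_lt_one (by positivity)]; norm_num)
  rw [← add_tsub_cancel_of_le hn.le, CFC.nnrpow_add (by positivity) (tsub_pos_of_lt hn)]
  exact P.mul_mem_right _ _ (hpow n)

theorem IsSemiprimeIdeal.exists_mul_of_posPow_mem {P : TwoSidedIdeal A} (hP : IsSemiprimeIdeal P)
    {x : A} {k : ℕ} (h : posPow (star x * x) k ∈ P) : ∃ r, ∃ z ∈ P, IsSelfAdjoint z ∧ x = r * z := by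
  set b := star x * x with hb
  have hb0 : 0 ≤ b := star_mul_self_nonneg x
  have hz0 : 0 ≤ b ^ (1 / 3 : NNReal) := CFC.nnrpow_nonneg
  have hzP : b ^ (1 / 3 : NNReal) ∈ P := by
    rw [posPow_eq_nnrpow hb0] at h
    have hk : (k : NNReal) + 1 ≠ 0 := by positivity
    have := hP.nnrpow_mem_of_pos CFC.nnrpow_nonneg h
      (p := ((k : NNReal) + 1)⁻¹ * (1 / 3)) (by positivity)
    rwa [CFC.nnrpow_nnrpow, ← mul_assoc, mul_inv_cancel₀ hk, one_mul] at this
  obtain ⟨r, hr⟩ := exists_eq_mul_of_star_mul_self_le (x := x) hz0 (by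
    rw [← CFC.nnrpow_three _ hz0, CFC.nnrpow_nnrpow]
    norm_num
    rw [CFC.nnrpow_one _ hb0])
  exact ⟨r, _, hzP, .of_nonneg hz0, hr⟩

end CStar

theorem IsSemiprimeIdeal.subset_of_isRadicalOver {A : Type*} [NonUnitalCStarAlgebra A]
    {P : TwoSidedIdeal A} (hP : IsSemiprimeIdeal P) {J : AddSubgroup A}
    (hJ : IsOneSidedIdeal J) (hJP : IsRadicalOver (J : Set A) P) : (J : Set A) ⊆ P := by
  let _ := CStarAlgebra.spectralOrder A
  have := CStarAlgebra.spectralOrderedRing A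
  intro x hx
  rcases hJ with hJ | hJ
  -- The factor in `P` stands on the right for `x`; in the other case it is moved to the left by
  -- taking adjoints, as `z` is self-adjoint, so `P` need not be star-closed.
  · obtain ⟨k, hk⟩ := hJP _ (hJ (star x) x hx)
    obtain ⟨r, z, hz, -, rfl⟩ := hP.exists_mul_of_posPow_mem hk
    exact P.mul_mem_left _ _ hz
  · obtain ⟨k, hk⟩ := hJP _ (hJ (star x) x hx)
    obtain ⟨r, z, hz, hzs, h⟩ := hP.exists_mul_of_posPow_mem (x := star x) (by rwa [star_star])
    rw [← star_star x, h, star_mul, hzs.star_eq]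
    exact P.mul_mem_right _ _ hz

theorem subset_lowerNilradical_of_surjective {A R F : Type*} [NonUnitalCStarAlgebra A]
    [NonUnitalRing R] [FunLike F A R] [NonUnitalRingHomClass F A R] {f : F}
    (hf : Function.Surjective f) {L : AddSubgroup R}
    (hL : IsOneSidedIdeal L) (hnil : IsNil (L : Set R)) :
    (L : Set R) ⊆ lowerNilradical R := by
  intro y hy
  refine mem_semiprimeClosure.2 fun Q hQ _ => ?_
  obtain ⟨x, rfl⟩ := hf y
  have hJ : IsOneSidedIdeal (L.comap (f : A →+ R)) := by
    refine hL.imp (fun h a x hx => ?_) (fun h a x hx => ?_)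
    · simpa using h (f a) (f x) hx
    · simpa using h (f a) (f x) hx
  refine (TwoSidedIdeal.mem_comap f).1
    ((hQ.isSemiprimeIdeal.comap hf).subset_of_isRadicalOver hJ (fun a ha => ?_) hy)
  obtain ⟨k, hk⟩ := hnil (f a) ha
  refine ⟨k, ?_⟩
  rw [TwoSidedIdeal.mem_comap, map_posPow, hk]
  exact Q.zero_mem

theorem lowerNilradical_eq_upperNilradical_of_surjective {A R F : Type*}
    [NonUnitalCStarAlgebra A] [NonUnitalRing R] [FunLike F A R] [NonUnitalRingHomClass F A R]
    {f : F} (hf : Function.Surjective f) : lowerNilradical R = upperNilradical R := by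
  refine le_antisymm ((isGreatest_upperNilradical R).2 (isNil_lowerNilradical R)) ?_
  let N : AddSubgroup R :=
    { carrier := upperNilradical R
      zero_mem' := (upperNilradical R).zero_mem
      add_mem' := (upperNilradical R).add_mem
      neg_mem' := (upperNilradical R).neg_mem }
  exact subset_lowerNilradical_of_surjective hf (L := N)
    (.inl fun a x hx => (upperNilradical R).mul_mem_left a x hx)
    (isGreatest_upperNilradical R).1

end RingRadicals

theorem corollary4p9 {A : Type*} [NonUnitalCStarAlgebra A] (I : TwoSidedIdeal A) :
    (∀ J : AddSubgroup A, RingRadicals.IsOneSidedIdeal J →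
      RingRadicals.IsRadicalOver (J : Set A) I →
        (J : Set A) ⊆ (RingRadicals.semiprimeClosure I : Set A)) ∧
    RingRadicals.lowerNilradical I.ringCon.Quotient
      = RingRadicals.upperNilradical I.ringCon.Quotient ∧
    (∀ L : AddSubgroup I.ringCon.Quotient, RingRadicals.IsOneSidedIdeal L →
      RingRadicals.IsNil (L : Set I.ringCon.Quotient) →
        (L : Set I.ringCon.Quotient)
          ⊆ (RingRadicals.upperNilradical I.ringCon.Quotient : Set I.ringCon.Quotient)) := by
  let π : A →ₙ+* I.ringCon.Quotient :=
    { toFun := fun a => (a : I.ringCon.Quotient)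
      map_mul' := fun _ _ => rfl
      map_zero' := rfl
      map_add' := fun _ _ => rfl }
  have hπ : Function.Surjective π := Quotient.mk''_surjective
  have heq := RingRadicals.lowerNilradical_eq_upperNilradical_of_surjective hπ
  refine ⟨fun J hJ hJI x hx => ?_, heq, fun L hL hnil => ?_⟩
  · refine RingRadicals.mem_semiprimeClosure.2 fun P hP hIP => ?_
    exact hP.isSemiprimeIdeal.subset_of_isRadicalOver hJ
      (fun y hy => (hJI y hy).imp fun k hk => hIP hk) hx
  · rw [← heq]
    exact RingRadicals.subset_lowerNilradical_of_surjective hπ hL hnil
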